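/- For an entire function $f:\mathbb{C}\to\mathbb{C}$ let $\mathrm{type}(f)$ be the infimum of all real $\beta$ such that $|f(z)|\le Ce^{\beta|z|}$ for all $z\in\mathbb{C}$ with some constant $C$ ($+\infty$ if there is no such $\beta$). For locally integrable $g:\mathbb{R}\to\mathbb{C}$ put $$\|g\|_{BMO}=\sup_I\frac1{|I|}\int_I\Big|g(t)-\frac1{|I|}\int_I g(s)\,ds\Big|\,dt,$$ the supremum being over all bounded intervals $I\subset\mathbb{R}$ of positive length. For $b\ge 0$ let $PW_b^\star$ be the space of entire functions $f$ with $\mathrm{type}(f)\le\pi b$ and $\|f|_{\mathbb{R}}\|_{BMO}<\infty$, and let $PW_b^\infty$ be the space of $g\in L^\infty(\mathbb{R})$ whose Fourier transform $\hat g$, in the sense of tempered distributions with the normalization $\hat g(\omega)=\int g(t)e^{-2\pi i\omega t}\,dt$, is supported in $[-\frac b2,\frac b2]$. A strictly increasing sequence $X=\{x_k\}_{k\in\mathbb{Z}}\subset\mathbb{R}$ is separated if $\inf_k|x_{k+1}-x_k|>0$, and its lower uniform density is $$D^-(X)=\limsup_{r\to\infty}\,\inf_{a\in\mathbb{R}}\frac{\#\{k:\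 x_k\in[a,a+r)\}}{r}.$$ Let $b\ge 0$ and $f\in PW_b^\star$. Then either $f|_{\mathbb{R}}\in PW_b^\infty$, or there is no separated sequence $X$ with $D^-(X)>0$ such that $f(X)=\{f(x_k)\}_{k\in\mathbb{Z}}$ is bounded. In particular, if $f|_{\mathbb{R}}\notin PW_b^\infty$, then for every sampling rate $s>0$ the samples $\{f(k/s)\}_{k\in\mathbb{Z}}$ are unbounded. -/

import Mathlib

open MeasureTheory Filter
open scoped ENNReal FourierTransform SchwartzMap

noncomputable section

namespace BandlimitedBMO

/-- The exponential type of `f : ℂ → ℂ`: the infimum of all real `β` for which `f` is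
`O(exp (β |z|))` on `ℂ`. It is `⊤` if `f` is not entire or satisfies no such bound. -/
def exponentialType (f : ℂ → ℂ) : EReal :=
  ⨅ (β : ℝ) (_ : Differentiable ℂ f ∧ ∃ C : ℝ, ∀ z : ℂ, ‖f z‖ ≤ C * Real.exp (β * ‖z‖)),
    (β : EReal)

/-- The `BMO` seminorm of `g : ℝ → ℂ`: the supremum over all bounded intervals `I` of the mean
over `I` of `|g - g_I|`, where `g_I` is the mean of `g` over `I`. -/
def bmoSeminorm (g : ℝ → ℂ) : ℝ≥0∞ :=
  ⨆ (u : ℝ) (v : ℝ) (_ : u < v),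
    ⨍⁻ t in Set.Icc u v, ‖g t - ⨍ s in Set.Icc u v, g s‖ₑ ∂volume

/-- `g` is locally integrable and of bounded mean oscillation. -/
def MemBMO (g : ℝ → ℂ) : Prop :=
  LocallyIntegrable g ∧ bmoSeminorm g < ∞

/-- The space `PW_b^⋆` of entire functions of exponential type at most `π b` whose restriction
to the real line lies in `BMO`. -/
def PWStar (b : ℝ) : Set (ℂ → ℂ) :=
  {f | exponentialType f ≤ ((Real.pi * b : ℝ) : EReal) ∧ MemBMO (fun t : ℝ => f t)}

/-- The Paley-Wiener space `PW_b^p` of all `g ∈ L^p(ℝ)` whose Fourier transform, in the sense of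
tempered distributions, is supported in `[-b/2, b/2]`. -/
def PW (b : ℝ) (p : ℝ≥0∞) [Fact (1 ≤ p)] : Set (ℝ → ℂ) :=
  {g | ∃ hg : MemLp g p volume,
    Distribution.dsupport (𝓕 (hg.toLp g : 𝓢'(ℝ, ℂ)) : 𝓢'(ℝ, ℂ)) ⊆ Set.Icc (-(b / 2)) (b / 2)}

/-- The separation constant of a sequence of points. -/
def separationConstant (x : ℤ → ℝ) : ℝ :=
  ⨅ k : ℤ, |x (k + 1) - x k|

/-- A separated sequence: strictly increasing, with positive separation constant. -/
def IsSeparatedSeq (x : ℤ → ℝ) : Prop :=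
  StrictMono x ∧ 0 < separationConstant x

/-- The number of points of the sequence in a set `I`. -/
def pointCount (x : ℤ → ℝ) (I : Set ℝ) : ℕ∞ :=
  {k : ℤ | x k ∈ I}.encard

/-- The lower uniform density of a sequence of points. -/
def lowerUniformDensity (x : ℤ → ℝ) : ℝ≥0∞ :=
  limsup (fun r : ℝ => ⨅ a : ℝ, (pointCount x (Set.Ico a (a + r)) : ℝ≥0∞) / ENNReal.ofReal r)
    atTop

end BandlimitedBMO

end

namespace BandlimitedBMO

open Complex Metric Topology

/-! ### Growth of entire functions of exponential type with weighted bounds on the real line -/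

/-! The heart is a Bernstein-type fact, `exists_norm_deriv_le`: `f'` is bounded on the real line.
Then boundedness on a relatively dense set, which positive lower density provides, spreads to all of
ℝ, and a Paley–Wiener argument (`mem_PW_top_of_bounded`) locates the spectrum.

For the derivative, let `F` be a primitive of `f`. The BMO condition bounds the second differences
of `F` at each step `h`, uniformly in `x`. As `F'' = f'`, such a difference is `h ^ 2 * f'` up to an
error of order `h ^ 3 * sup |f''|`, and for exponential type `sup |f''|` is controlled by `sup
|f'|`. For small `h` the error is absorbed. Absorption needs a finite supremum, so every estimate
carries the weight `(1 + ε|x|) ^ 2` with constants independent of `ε`; `f'` grows at most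
quadratically beforehand, and `ε → 0` removes the weight.

For the spectrum, `f` is made integrable by the factor `(1 - iεt)⁻²`, holomorphic in the upper
half-plane, where a contour argument applies. -/

theorem one_le_norm_one_add {w : ℂ} {ε : ℝ} (hε : 0 ≤ ε) (hw : 0 ≤ w.re) :
    1 ≤ ‖1 + (ε : ℂ) * w‖ := by
  have h := Complex.re_le_norm (1 + (ε : ℂ) * w)
  simp at h
  nlinarith [mul_nonneg hε hw]

/-- Phragmén–Lindelöf for `g(w) e^{-βw} / (1 + εw)²`: the divisor has modulus at least 1 in the
half-plane, and the exponential makes the quotient bounded on the positive real axis. The factor 2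
comes from `(1 + ε|y|)² ≤ 2 |1 + iεy|²`. -/
theorem norm_le_of_bound_imaginary_axis {g : ℂ → ℂ} (hg : Differentiable ℂ g) {C β ε M : ℝ}
    (hβ : 0 ≤ β) (hε : 0 ≤ ε) (hexp : ∀ z, ‖g z‖ ≤ C * Real.exp (β * ‖z‖))
    (hM : ∀ y : ℝ, ‖g (y * I)‖ ≤ M * (1 + ε * |y|) ^ 2) {w : ℂ} (hw : 0 ≤ w.re) :
    ‖g w‖ ≤ 2 * M * (1 + ε * ‖w‖) ^ 2 * Real.exp (β * w.re) := by
  have hC : 0 ≤ C := by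
    have := (norm_nonneg _).trans (hexp 0)
    simpa using this
  have hM0 : 0 ≤ M := by
    have := (norm_nonneg _).trans (hM 0)
    simpa using this
  set G : ℂ → ℂ := fun w => g w * cexp (-(β * w)) / (1 + ε * w) ^ 2 with hG
  have hne : ∀ w : ℂ, 0 ≤ w.re → (1 + (ε : ℂ) * w) ^ 2 ≠ 0 := fun w hw =>
    pow_ne_zero _ (norm_pos_iff.1 (one_pos.trans_le (one_le_norm_one_add hε hw)))
  have hGn : ∀ w : ℂ, ‖G w‖ = ‖g w‖ * Real.exp (-(β * w.re)) / ‖1 + (ε : ℂ) * w‖ ^ 2 := by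
    intro w
    simp [hG, Complex.norm_exp]
  have hGle : ∀ w : ℂ, 0 ≤ w.re → ‖G w‖ ≤ ‖g w‖ * Real.exp (-(β * w.re)) := by
    intro w hw
    rw [hGn]
    exact div_le_self (by positivity) (one_le_pow₀ (one_le_norm_one_add hε hw))
  have hd : DiffContOnCl ℂ G {z | 0 < z.re} := by
    apply DifferentiableOn.diffContOnCl
    rw [Complex.closure_setOfPred_lt_re]
    intro z hz
    exact (((hg z).mul (by fun_prop)).div (by fun_prop) (hne z hz)).differentiableWithinAt
  have key : ‖G w‖ ≤ 2 * M := by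
    refine PhragmenLindelof.right_half_plane_of_bounded_on_real hd
      ⟨1, by norm_num, β, ?_⟩ ?_ ?_ hw
    · refine Asymptotics.IsBigO.of_bound C ?_
      refine Filter.eventually_inf_principal.2 (Eventually.of_forall fun z hz => ?_)
      have hz' : 0 ≤ z.re := le_of_lt hz
      refine (hGle z hz').trans ?_
      rw [Real.rpow_one, Real.norm_eq_abs, abs_of_pos (Real.exp_pos _)]
      refine (mul_le_of_le_one_right (norm_nonneg _) ?_).trans (hexp z)
      exact Real.exp_le_one_iff.2 (by nlinarith [mul_nonneg hβ hz'])
    · refine ⟨C, Filter.eventually_map.2 ?_⟩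
      filter_upwards [eventually_ge_atTop 0] with x hx
      refine (hGle x (by simpa using hx)).trans ?_
      refine (mul_le_mul_of_nonneg_right (hexp x) (Real.exp_pos _).le).trans ?_
      rw [mul_assoc, ← Real.exp_add]
      simp [abs_of_nonneg hx]
    · intro y
      rw [hGn]
      have h1 : ‖1 + (ε : ℂ) * (y * I)‖ ^ 2 = 1 + (ε * y) ^ 2 := by
        rw [← Complex.normSq_eq_norm_sq, Complex.normSq_apply]
        simp
        ring
      rw [h1, div_le_iff₀ (by positivity)]
      have : (1 + ε * |y|) ^ 2 ≤ 2 * (1 + (ε * y) ^ 2) := by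
        have h2 : (ε * y) ^ 2 = (ε * |y|) ^ 2 := by rw [mul_pow, mul_pow, sq_abs]
        rw [h2]
        nlinarith [sq_nonneg (1 - ε * |y|)]
      have h3 := hM y
      simp only [mul_re, ofReal_re, I_re, mul_zero, ofReal_im, I_im, mul_one, sub_self,
        neg_zero, Real.exp_zero]
      nlinarith
  have hn : ‖1 + (ε : ℂ) * w‖ ≤ 1 + ε * ‖w‖ := by
    refine (norm_add_le _ _).trans ?_
    simp [abs_of_nonneg hε]
  rw [hGn, div_le_iff₀ (pow_pos (one_pos.trans_le (one_le_norm_one_add hε hw)) 2),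
    Real.exp_neg, ← div_eq_mul_inv, div_le_iff₀ (Real.exp_pos _)] at key
  refine key.trans ?_
  gcongr

theorem norm_le_of_bound_real_axis {f : ℂ → ℂ} (hf : Differentiable ℂ f) {C β ε M : ℝ}
    (hβ : 0 ≤ β) (hε : 0 ≤ ε) (hexp : ∀ z, ‖f z‖ ≤ C * Real.exp (β * ‖z‖))
    (hM : ∀ x : ℝ, ‖f x‖ ≤ M * (1 + ε * |x|) ^ 2) (z : ℂ) :
    ‖f z‖ ≤ 2 * M * (1 + ε * ‖z‖) ^ 2 * Real.exp (β * |z.im|) := by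
  rcases le_total 0 z.im with h | h
  · have := norm_le_of_bound_imaginary_axis (g := fun w => f (I * w)) (w := -I * z) (ε := ε)
      (M := M) (by fun_prop) hβ hε (fun w => by simpa using hexp (I * w))
      (fun y => by
        have := hM (-y)
        rwa [abs_neg, show ((-y : ℝ) : ℂ) = I * (y * I) by
          rw [mul_left_comm, I_mul_I]; simp] at this) (by simpa using h)
    have e : I * (-I * z) = z := by rw [← mul_assoc]; simp
    have e' : (-I * z).re = z.im := by simp
    simp only [e, e'] at this
    simpa [abs_of_nonneg h] using this
  · have := norm_le_of_bound_imaginary_axis (g := fun w => f (-I * w)) (w := I * z) (ε := ε)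
      (M := M) (by fun_prop) hβ hε (fun w => by simpa using hexp (-I * w))
      (fun y => by
        have := hM y
        rwa [show (y : ℂ) = -I * (y * I) by
          rw [mul_left_comm, neg_mul, I_mul_I]; simp] at this) (by simpa using h)
    have e : -I * (I * z) = z := by rw [← mul_assoc]; simp
    simp only [e] at this
    simpa [abs_of_nonpos h] using this

theorem norm_deriv_le_exp {f : ℂ → ℂ} (hf : Differentiable ℂ f) {C β : ℝ} (hβ : 0 ≤ β)
    (hexp : ∀ z, ‖f z‖ ≤ C * Real.exp (β * ‖z‖)) (z : ℂ) :
    ‖deriv f z‖ ≤ C * Real.exp β * Real.exp (β * ‖z‖) := by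
  have hC : 0 ≤ C := by
    have := (norm_nonneg _).trans (hexp 0)
    simpa using this
  have := Complex.norm_deriv_le_of_forall_mem_sphere_norm_le (c := z) one_pos hf.diffContOnCl
    (C := C * Real.exp β * Real.exp (β * ‖z‖)) (fun w hw => (hexp w).trans ?_)
  · simpa using this
  · rw [mul_assoc, ← Real.exp_add]
    have h1 : ‖w‖ ≤ ‖z‖ + 1 := by
      rw [mem_sphere_iff_norm] at hw
      have := norm_sub_norm_le w z
      linarith
    gcongr
    nlinarith

/-- Cauchy's estimate on a unit circle, which stays within distance 2 of `x`. As `ε ≤ 1`, the weight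
base grows there by at most a factor 3, so `18 = 2 * 3 ^ 2` serves for all such `ε`. -/
theorem norm_deriv_le_of_bound_real_axis {f : ℂ → ℂ} (hf : Differentiable ℂ f) {C β ε M : ℝ}
    (hβ : 0 ≤ β) (hε : 0 ≤ ε) (hε1 : ε ≤ 1) (hexp : ∀ z, ‖f z‖ ≤ C * Real.exp (β * ‖z‖))
    (hM : ∀ x : ℝ, ‖f x‖ ≤ M * (1 + ε * |x|) ^ 2) (x : ℝ) {z : ℂ} (hz : ‖z - x‖ ≤ 1) :
    ‖deriv f z‖ ≤ 18 * Real.exp (2 * β) * M * (1 + ε * |x|) ^ 2 := by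
  have hM0 : 0 ≤ M := by
    have := (norm_nonneg _).trans (hM 0)
    simpa using this
  have := Complex.norm_deriv_le_of_forall_mem_sphere_norm_le (c := z) one_pos hf.diffContOnCl
    (C := 18 * Real.exp (2 * β) * M * (1 + ε * |x|) ^ 2)
    (fun w hw => (norm_le_of_bound_real_axis hf hβ hε hexp hM w).trans ?_)
  · simpa using this
  · have hwx : ‖w - x‖ ≤ 2 := by
      rw [mem_sphere_iff_norm] at hw
      have := norm_add_le (w - z) (z - x)
      rw [sub_add_sub_cancel] at this
      linarith
    have h1 : ‖w‖ ≤ |x| + 2 := by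
      have := norm_sub_norm_le w x
      rw [Complex.norm_real, Real.norm_eq_abs] at this
      linarith
    have h2 : |w.im| ≤ 2 := by
      have := Complex.abs_im_le_norm (w - x)
      simp at this
      linarith
    have h3 : 1 + ε * ‖w‖ ≤ 3 * (1 + ε * |x|) := by
      nlinarith [mul_nonneg hε (abs_nonneg x), mul_le_mul_of_nonneg_left h1 hε]
    calc 2 * M * (1 + ε * ‖w‖) ^ 2 * Real.exp (β * |w.im|)
        ≤ 2 * M * (3 * (1 + ε * |x|)) ^ 2 * Real.exp (2 * β) := by
          have : β * |w.im| ≤ 2 * β := by nlinarith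
          gcongr
      _ = _ := by ring

/-! ### Second differences -/

/-- A second difference of a primitive of a primitive approximates the function itself. -/
theorem norm_second_difference_sub_le {F f g : ℂ → ℂ} (hF : ∀ z, HasDerivAt F (f z) z)
    (hf : ∀ z, HasDerivAt f (g z) z) (hg : Differentiable ℂ g) {x h L : ℝ} (hh : 0 ≤ h)
    (hL : ∀ z : ℂ, ‖z - x‖ ≤ 2 * h → ‖deriv g z‖ ≤ L) :
    ‖F ((x + 2 * h : ℝ)) - 2 * F ((x + h : ℝ)) + F x - h ^ 2 * g x‖ ≤ 2 * h ^ 3 * L := by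
  have hnh : ‖(h : ℂ)‖ = h := by simp [abs_of_nonneg hh]
  -- Three nested mean value inequalities, for `g`, for `f` and for `F`, contribute the factors
  -- `2h`, `h` and `h`.
  have h1 : ∀ z : ℂ, ‖z - x‖ ≤ 2 * h → ‖g z - g x‖ ≤ 2 * h * L := by
    intro z hz
    have := (convex_closedBall (x : ℂ) (2 * h)).norm_image_sub_le_of_norm_deriv_le
      (f := g) (C := L) (x := x) (y := z) (fun y _ => hg y)
      (fun y hy => hL y (mem_closedBall_iff_norm.1 hy))
      (by simp [hh]) (mem_closedBall_iff_norm.2 hz)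
    have hL0 : 0 ≤ L := (norm_nonneg _).trans (hL x (by simp [hh]))
    nlinarith
  have h2 : ∀ s : ℂ, ‖s - x‖ ≤ h → ‖f (s + h) - f s - h * g x‖ ≤ 2 * h * L * h := by
    intro s hs
    have hd : ∀ y : ℂ, HasDerivAt (fun y => f y - y * g x) (g y - g x) y := fun y =>
      (hf y).sub (by simpa using (hasDerivAt_id y).mul_const (g x))
    have := (convex_closedBall (x : ℂ) (2 * h)).norm_image_sub_le_of_norm_hasDerivWithin_le
      (f := fun y => f y - y * g x) (C := 2 * h * L) (x := s) (y := s + h)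
      (fun y _ => (hd y).hasDerivWithinAt)
      (fun y hy => h1 y (mem_closedBall_iff_norm.1 hy))
      (by rw [mem_closedBall_iff_norm]; linarith)
      (by
        rw [mem_closedBall_iff_norm]
        have := norm_add_le (s - x) (h : ℂ)
        rw [show s + h - x = s - x + h by ring]
        linarith)
    rw [add_sub_cancel_left, hnh] at this
    calc _ = ‖f (s + h) - (s + h) * g x - (f s - s * g x)‖ := by congr 1; ring
      _ ≤ _ := this
  have hd : ∀ y : ℂ, HasDerivAt (fun y => F (y + h) - F y - h * g x * y)
      (f (y + h) - f y - h * g x) y := fun y =>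
    (((hF (y + h)).comp_add_const y (h : ℂ)).sub (hF y)).sub
      (by simpa using (hasDerivAt_id y).const_mul (h * g x))
  have := (convex_closedBall (x : ℂ) h).norm_image_sub_le_of_norm_hasDerivWithin_le
      (C := 2 * h * L * h) (x := (x : ℂ)) (y := x + h)
      (fun y _ => (hd y).hasDerivWithinAt)
      (fun y hy => h2 y (mem_closedBall_iff_norm.1 hy))
      (by simp [hh]) (by simp [abs_of_nonneg hh])
  rw [add_sub_cancel_left, hnh] at this
  convert this using 1
  · congr 1
    push_cast
    rw [show (x : ℂ) + h + h = x + 2 * h by ring]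
    ring
  · ring

/-- Walk from `x` to `[-1, 1]` in unit steps: about `|x|` steps, each of cost at most a multiple of
`(1 + |x|) ^ n`, raise the power by one. -/
theorem norm_le_of_difference_le {ψ : ℝ → ℂ} (hψ : Continuous ψ) {A : ℝ} {n : ℕ}
    (h : ∀ x, ‖ψ (x + 1) - ψ x‖ ≤ A * (1 + |x|) ^ n) :
    ∃ K, ∀ x, ‖ψ x‖ ≤ K * (1 + |x|) ^ (n + 1) := by
  obtain ⟨K, hK⟩ := isCompact_Icc.exists_bound_of_continuousOn (s := Set.Icc (-1 : ℝ) 1)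
    hψ.continuousOn
  have hK0 : 0 ≤ K := (norm_nonneg _).trans (hK 0 (by simp))
  have hA : 0 ≤ A := by
    have := (norm_nonneg _).trans (h 0)
    simpa using this
  have key : ∀ m : ℕ, ∀ x : ℝ, |x| ≤ m → ‖ψ x‖ ≤ K + m * A * (1 + m) ^ n := by
    intro m
    induction m with
    | zero =>
      intro x hx
      have : x = 0 := by simpa using hx
      simpa [this] using hK 0 (by simp)
    | succ m ih =>
      intro x hx
      push_cast at hx ⊢
      by_cases h1 : |x| ≤ 1
      · exact (hK x (abs_le.1 h1)).trans (le_add_of_nonneg_right (by positivity))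
      have hstep : ∀ y : ℝ, |y| ≤ m → ∀ d : ℝ, d ≤ A * (1 + (m + 1)) ^ n →
          ‖ψ y‖ + d ≤ K + (m + 1) * A * (1 + (m + 1 : ℝ)) ^ n := by
        intro y hy d hd
        have h2 := ih y hy
        have h3 : (m : ℝ) * A * (1 + m) ^ n ≤ m * A * (1 + (m + 1)) ^ n := by gcongr; linarith
        linarith
      rcases le_total 0 x with h0 | h0
      · rw [abs_of_nonneg h0] at h1 hx
        have hy : |x - 1| ≤ m := by rw [abs_of_nonneg (by linarith)]; linarith
        have h2 := h (x - 1)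
        rw [sub_add_cancel] at h2
        have h3 := norm_sub_norm_le (ψ x) (ψ (x - 1))
        have h4 : A * (1 + |x - 1|) ^ n ≤ A * (1 + (m + 1 : ℝ)) ^ n := by gcongr; linarith
        linarith [hstep (x - 1) hy _ (h2.trans h4)]
      · rw [abs_of_nonpos h0] at h1 hx
        have hy : |x + 1| ≤ m := by rw [abs_of_nonpos (by linarith)]; linarith
        have h2 := h x
        have h3 := norm_sub_norm_le (ψ x) (ψ (x + 1))
        rw [norm_sub_rev] at h3
        have h4 : A * (1 + |x|) ^ n ≤ A * (1 + (m + 1 : ℝ)) ^ n := by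
          gcongr
          rw [abs_of_nonpos h0]
          linarith
        linarith [hstep (x + 1) hy _ (h2.trans h4)]
  refine ⟨K + A * 2 ^ n, fun x => ?_⟩
  have hm := (Nat.ceil_lt_add_one (abs_nonneg x)).le
  refine (key _ x (Nat.le_ceil _)).trans ?_
  have h1 : (⌈|x|⌉₊ : ℝ) * A * (1 + ⌈|x|⌉₊) ^ n ≤ (1 + |x|) * A * (2 * (1 + |x|)) ^ n := by
    gcongr
    · linarith
    · linarith [abs_nonneg x]
  have h2 : 1 ≤ (1 + |x|) ^ (n + 1) := one_le_pow₀ (by linarith [abs_nonneg x])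
  calc K + ⌈|x|⌉₊ * A * (1 + (⌈|x|⌉₊ : ℝ)) ^ n
      ≤ K * (1 + |x|) ^ (n + 1) + (1 + |x|) * A * (2 * (1 + |x|)) ^ n := by nlinarith
    _ = _ := by rw [mul_pow]; ring

theorem norm_le_of_second_difference_le {ψ : ℝ → ℂ} (hψ : Continuous ψ) {B : ℝ}
    (h : ∀ x, ‖ψ (x + 2) - 2 * ψ (x + 1) + ψ x‖ ≤ B) :
    ∃ K, ∀ x, ‖ψ x‖ ≤ K * (1 + |x|) ^ 2 := by
  obtain ⟨A, hA⟩ := norm_le_of_difference_le (ψ := fun x => ψ (x + 1) - ψ x) (A := B) (n := 0)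
    (by fun_prop) (fun x => by
      convert h x using 2
      · rw [show x + 1 + 1 = x + 2 by ring]
        ring
      · simp)
  exact norm_le_of_difference_le hψ hA

/-- If the second differences of `F` are bounded on the real line at every scale, so is `F''`. -/
theorem norm_second_derivative_le_of_second_difference_le {F f g : ℂ → ℂ}
    (hF : ∀ z, HasDerivAt F (f z) z) (hf : ∀ z, HasDerivAt f (g z) z) {C β : ℝ} (hβ : 0 ≤ β)
    (hexp : ∀ z, ‖F z‖ ≤ C * Real.exp (β * ‖z‖))
    (hdiff : ∀ h : ℝ, 0 < h → ∃ B, ∀ x : ℝ,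
      ‖F ((x + 2 * h : ℝ)) - 2 * F ((x + h : ℝ)) + F x‖ ≤ B) :
    ∃ L, ∀ x : ℝ, ‖g x‖ ≤ L := by
  have hFd : Differentiable ℂ F := fun z => (hF z).differentiableAt
  have hfd : Differentiable ℂ f := fun z => (hf z).differentiableAt
  have hdF : deriv F = f := funext fun z => (hF z).deriv
  have hdf : deriv f = g := funext fun z => (hf z).deriv
  have hgd : Differentiable ℂ g := hdf ▸ fun z => (hfd.analyticAt z).deriv.differentiableAt
  have hfexp := hdF ▸ norm_deriv_le_exp hFd hβ hexp
  have hgexp := hdf ▸ norm_deriv_le_exp hfd hβ hfexp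
  -- A priori growth: step 1 makes `F` at most quadratic, and two differentiations preserve the
  -- weight.
  obtain ⟨K, hK⟩ : ∃ K, ∀ x : ℝ, ‖g x‖ ≤ K * (1 + |x|) ^ 2 := by
    obtain ⟨B, hB⟩ := hdiff 1 one_pos
    obtain ⟨K, hK⟩ := norm_le_of_second_difference_le (ψ := fun x : ℝ => F x)
      (hFd.continuous.comp continuous_ofReal) (B := B) (fun x => by simpa using hB x)
    have h1 : ∀ x : ℝ, ‖f x‖ ≤ 18 * Real.exp (2 * β) * K * (1 + 1 * |x|) ^ 2 := fun x =>
      hdF ▸ norm_deriv_le_of_bound_real_axis hFd hβ zero_le_one le_rfl hexp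
        (by simpa using hK) x (z := x) (by simp)
    have h2 : ∀ x : ℝ, ‖g x‖ ≤ _ := fun x =>
      hdf ▸ norm_deriv_le_of_bound_real_axis hfd hβ zero_le_one le_rfl hfexp h1 x (z := x)
        (by simp)
    exact ⟨_, by simpa using h2⟩
  have hK0 : 0 ≤ K := by
    have := (norm_nonneg _).trans (hK 0)
    simpa using this
  -- Chosen so that the error `2h³ · 18e^{2β}M` equals `h²M/2`; moreover `2h ≤ 1` keeps the disc
  -- inside the range of the derivative bound.
  set h : ℝ := (72 * Real.exp (2 * β))⁻¹ with hh
  have he : 1 ≤ Real.exp (2 * β) := Real.one_le_exp (by positivity)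
  have hpos : 0 < h := by positivity
  have hmul : h * (72 * Real.exp (2 * β)) = 1 := inv_mul_cancel₀ (by positivity)
  have hle : 2 * h ≤ 1 := by nlinarith
  obtain ⟨B, hB⟩ := hdiff h hpos
  have hB0 : 0 ≤ B := (norm_nonneg _).trans (hB 0)
  have hstep : ∀ ε : ℝ, 0 ≤ ε → ε ≤ 1 → ∀ M, (∀ x : ℝ, ‖g x‖ ≤ M * (1 + ε * |x|) ^ 2) →
      ∀ x : ℝ, ‖g x‖ ≤ (B / h ^ 2 + M / 2) * (1 + ε * |x|) ^ 2 := by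
    intro ε hε hε1 M hM x
    have h1 := norm_second_difference_sub_le hF hf hgd (x := x) hpos.le (fun z hz =>
      norm_deriv_le_of_bound_real_axis hgd hβ hε hε1 hgexp hM x (hz.trans hle))
    have h2 := norm_sub_norm_le ((h : ℂ) ^ 2 * g x)
      (F ((x + 2 * h : ℝ)) - 2 * F ((x + h : ℝ)) + F x)
    rw [norm_sub_rev, norm_mul, norm_pow, Complex.norm_real, Real.norm_eq_abs,
      abs_of_pos hpos] at h2
    have h3 := hB x
    have h4 : h ^ 2 * ‖g x‖ ≤ B + h ^ 2 * (M / 2 * (1 + ε * |x|) ^ 2) := by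
      have : 2 * h ^ 3 * (18 * Real.exp (2 * β) * M * (1 + ε * |x|) ^ 2)
          = h ^ 2 * (M / 2 * (1 + ε * |x|) ^ 2) * (h * (72 * Real.exp (2 * β))) := by ring
      rw [hmul, mul_one] at this
      linarith
    have h5 : ‖g x‖ ≤ B / h ^ 2 + M / 2 * (1 + ε * |x|) ^ 2 := by
      rw [← sub_le_iff_le_add, le_div_iff₀ (by positivity)]
      linarith
    have h6 : 1 ≤ (1 + ε * |x|) ^ 2 := one_le_pow₀ (by nlinarith [mul_nonneg hε (abs_nonneg x)])
    have h7 : 0 ≤ B / h ^ 2 := by positivity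
    nlinarith
  -- Iterating `M ↦ B/h² + M/2`, whose fixed point is `2B/h²`. The start `K/ε²` is legitimate
  -- because `ε(1 + |x|) ≤ 1 + ε|x|`; its contribution dies as `n → ∞` with `ε` fixed.
  have hiter : ∀ ε : ℝ, 0 < ε → ε ≤ 1 → ∀ n : ℕ, ∀ x : ℝ,
      ‖g x‖ ≤ (2 * (B / h ^ 2) + K / ε ^ 2 * (1 / 2) ^ n) * (1 + ε * |x|) ^ 2 := by
    intro ε hε hε1 n
    induction n with
    | zero =>
      intro x
      have h1 : K * (1 + |x|) ^ 2 ≤ K / ε ^ 2 * (1 + ε * |x|) ^ 2 := by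
        rw [div_mul_eq_mul_div, le_div_iff₀ (by positivity), mul_assoc, ← mul_pow]
        gcongr
        nlinarith
      have h7 : 0 ≤ B / h ^ 2 := by positivity
      have h6 : 0 ≤ (1 + ε * |x|) ^ 2 := by positivity
      have := (hK x).trans h1
      simp only [pow_zero, mul_one]
      nlinarith
    | succ n ih =>
      intro x
      refine (hstep ε hε.le hε1 _ ih x).trans (le_of_eq ?_)
      ring
  refine ⟨2 * (B / h ^ 2), fun x => ?_⟩
  have hlim1 : ∀ ε : ℝ, 0 < ε → ε ≤ 1 → ‖g x‖ ≤ 2 * (B / h ^ 2) * (1 + ε * |x|) ^ 2 := by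
    intro ε hε hε1
    have ht : Tendsto (fun n : ℕ =>
        (2 * (B / h ^ 2) + K / ε ^ 2 * (1 / 2 : ℝ) ^ n) * (1 + ε * |x|) ^ 2) atTop
        (𝓝 ((2 * (B / h ^ 2) + K / ε ^ 2 * 0) * (1 + ε * |x|) ^ 2)) :=
      ((tendsto_pow_atTop_nhds_zero_of_lt_one (by norm_num)
        (by norm_num)).const_mul _ |>.const_add _).mul_const _
    rw [mul_zero, add_zero] at ht
    exact ge_of_tendsto' ht fun n => hiter ε hε hε1 n x
  have ht : Tendsto (fun ε : ℝ => 2 * (B / h ^ 2) * (1 + ε * |x|) ^ 2) (𝓝[>] 0)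
      (𝓝 (2 * (B / h ^ 2))) := by
    have : Continuous fun ε : ℝ => 2 * (B / h ^ 2) * (1 + ε * |x|) ^ 2 := by fun_prop
    simpa using (this.tendsto 0).mono_left nhdsWithin_le_nhds
  refine ge_of_tendsto ht ?_
  filter_upwards [Ioc_mem_nhdsGT one_pos] with ε hε
  exact hlim1 ε hε.1 hε.2

/-! ### Bounded mean oscillation -/

theorem integral_norm_sub_average_le {g : ℝ → ℂ} (hg : Continuous g) (hbmo : bmoSeminorm g < ∞)
    {u v : ℝ} (huv : u < v) :
    ∫ t in u..v, ‖g t - ⨍ s in Set.Icc u v, g s‖ ≤ (bmoSeminorm g).toReal * (v - u) := by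
  set c := ⨍ s in Set.Icc u v, g s
  have h1 : ⨍⁻ t in Set.Icc u v, ‖g t - c‖ₑ ∂volume ≤ bmoSeminorm g :=
    le_iSup_of_le u (le_iSup_of_le v (le_iSup_of_le huv le_rfl))
  have hvol : volume (Set.Icc u v) = ENNReal.ofReal (v - u) := Real.volume_Icc
  have hpos : 0 < v - u := sub_pos.2 huv
  rw [setLAverage_eq, hvol, ENNReal.div_le_iff (by simpa using huv) ENNReal.ofReal_ne_top] at h1
  rw [intervalIntegral.integral_of_le huv.le, ← integral_Icc_eq_integral_Ioc,
    integral_norm_eq_lintegral_enorm (by fun_prop)]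
  have h2 := ENNReal.toReal_mono (ENNReal.mul_ne_top hbmo.ne ENNReal.ofReal_ne_top) h1
  rwa [ENNReal.toReal_mul, ENNReal.toReal_ofReal hpos.le] at h2

/-- The second difference is the integral of `f` over the right half of `[x, x + 2h]` minus that
over the left half. The halves have equal length, so `f` may be replaced by `f` minus its mean over
the whole interval. -/
theorem norm_second_difference_primitive_le {f F : ℂ → ℂ} (hF : ∀ z, HasDerivAt F (f z) z)
    (hf : Continuous f) (hbmo : bmoSeminorm (fun t : ℝ => f t) < ∞) {h : ℝ} (hh : 0 < h) (x : ℝ) :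
    ‖F ((x + 2 * h : ℝ)) - 2 * F ((x + h : ℝ)) + F x‖
      ≤ (bmoSeminorm (fun t : ℝ => f t)).toReal * (2 * h) := by
  have hfr : Continuous fun t : ℝ => f t := hf.comp continuous_ofReal
  have ftc : ∀ u v : ℝ, ∫ t in u..v, f t = F v - F u := fun u v =>
    intervalIntegral.integral_eq_sub_of_hasDerivAt (fun t _ => (hF t).comp_ofReal)
      (hfr.intervalIntegrable _ _)
  have hbd := integral_norm_sub_average_le hfr hbmo (u := x) (v := x + 2 * h) (by linarith)
  set c := ⨍ s in Set.Icc x (x + 2 * h), f s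
  have hc : Continuous fun t : ℝ => f t - c := by fun_prop
  have hi : ∀ u v : ℝ, IntervalIntegrable (fun t : ℝ => ‖f t - c‖) volume u v :=
    fun u v => hc.norm.intervalIntegrable _ _
  have hsub : ∀ u v : ℝ, ∫ t in u..v, (f t - c) = F v - F u - (v - u) * c := fun u v => by
    rw [intervalIntegral.integral_sub (hfr.intervalIntegrable _ _) (by simp), ftc]
    simp
  have e : F ((x + 2 * h : ℝ)) - 2 * F ((x + h : ℝ)) + F x
      = (∫ t in (x + h)..(x + 2 * h), (f t - c)) - ∫ t in x..(x + h), (f t - c) := by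
    rw [hsub, hsub]
    push_cast
    ring
  rw [e]
  have h1 := intervalIntegral.norm_integral_le_integral_norm (μ := volume)
    (f := fun t : ℝ => f t - c) (show x + h ≤ x + 2 * h by linarith)
  have h2 := intervalIntegral.norm_integral_le_integral_norm (μ := volume)
    (f := fun t : ℝ => f t - c) (show x ≤ x + h by linarith)
  have h3 := intervalIntegral.integral_add_adjacent_intervals (hi x (x + h))
    (hi (x + h) (x + 2 * h))
  refine (norm_sub_le _ _).trans ?_
  rw [add_sub_cancel_left] at hbd
  linarith

/-- An entire function of exponential type with bounded mean oscillation on the real line has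
bounded derivative there. -/
theorem exists_norm_deriv_le {f : ℂ → ℂ} (hf : Differentiable ℂ f) {C β : ℝ} (hβ : 0 ≤ β)
    (hexp : ∀ z, ‖f z‖ ≤ C * Real.exp (β * ‖z‖)) (hbmo : bmoSeminorm (fun t : ℝ => f t) < ∞) :
    ∃ L, ∀ x : ℝ, ‖deriv f x‖ ≤ L := by
  have hC : 0 ≤ C := by
    have := (norm_nonneg _).trans (hexp 0)
    simpa using this
  obtain ⟨F₀, hF₀⟩ := hf.isExactOn_univ
  set F : ℂ → ℂ := fun z => F₀ z - F₀ 0 with hFdef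
  have hF : ∀ z, HasDerivAt F (f z) z := fun z => (hF₀ z trivial).sub_const _
  -- Since `F 0 = 0`, integration costs a factor `|z| ≤ e^{|z|}`, absorbed by raising `β` to `β +
  -- 1`.
  have hFexp : ∀ z, ‖F z‖ ≤ C * Real.exp ((β + 1) * ‖z‖) := by
    intro z
    have := (convex_closedBall (0 : ℂ) ‖z‖).norm_image_sub_le_of_norm_hasDerivWithin_le
      (f := F) (C := C * Real.exp (β * ‖z‖)) (x := 0) (y := z)
      (fun y _ => (hF y).hasDerivWithinAt)
      (fun y hy => (hexp y).trans (by
        have := mem_closedBall_zero_iff.1 hy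
        gcongr))
      (by simp) (by simp)
    rw [show F 0 = 0 by simp [hFdef], sub_zero, sub_zero] at this
    refine this.trans ?_
    rw [add_mul, Real.exp_add, one_mul, mul_assoc]
    have := Real.add_one_le_exp ‖z‖
    gcongr
    linarith
  exact norm_second_derivative_le_of_second_difference_le hF (fun z => (hf z).hasDerivAt)
    (by positivity) hFexp
    fun h hh => ⟨_, norm_second_difference_primitive_le hF hf.continuous hbmo hh⟩

/-! ### Spectrum of bounded entire functions of exponential type -/

theorem one_add_sq_le_norm_sq {w : ℂ} {ε : ℝ} (hε : 0 ≤ ε) (hw : 0 ≤ w.im) :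
    1 + (ε * w.re) ^ 2 ≤ ‖1 - I * ε * w‖ ^ 2 := by
  rw [← Complex.normSq_eq_norm_sq, Complex.normSq_apply]
  simp
  nlinarith [mul_nonneg hε hw, sq_nonneg (ε * w.im)]

theorem integrable_inv_one_add_mul_sq {ε : ℝ} (hε : 0 < ε) :
    Integrable fun x : ℝ => (1 + (ε * x) ^ 2)⁻¹ :=
  integrable_inv_one_add_sq.comp_mul_left' hε.ne'

/-- The integral over the real line of a function that is holomorphic and decays in the upper
half-plane vanishes. -/
theorem integral_eq_zero_of_decay_upperHalfPlane {H : ℂ → ℂ} {A c ε : ℝ} (hc : 0 < c) (hε : 0 < ε)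
    (hd : ∀ z : ℂ, 0 ≤ z.im → DifferentiableAt ℂ H z)
    (hH : ∀ z : ℂ, 0 ≤ z.im → ‖H z‖ ≤ A * Real.exp (-c * z.im) * (1 + (ε * z.re) ^ 2)⁻¹) :
    ∫ x : ℝ, H x = 0 := by
  have hA : 0 ≤ A := by
    have := (norm_nonneg _).trans (hH 0 (by simp))
    simpa using this
  have hcont : Continuous fun x : ℝ => H x := continuous_iff_continuousAt.2 fun x =>
    (hd x (by simp)).continuousAt.comp (f := ofReal) continuous_ofReal.continuousAt
  have hint : Integrable fun x : ℝ => H x := by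
    refine ((integrable_inv_one_add_mul_sq hε).const_mul A).mono' hcont.aestronglyMeasurable ?_
    exact Eventually.of_forall fun x => by simpa using hH x (by simp)
  have hlim := intervalIntegral_tendsto_integral hint tendsto_neg_atTop_atBot tendsto_id
  -- Cauchy on `[-R, R] × [0, R]`: the top edge gives the first term, the two vertical sides the
  -- second.
  have hbound : ∀ R : ℝ, 0 < R → ‖∫ x in (-R)..R, H x‖
      ≤ 2 * A * (R * Real.exp (-c * R)) + 2 * A * (R / (1 + (ε * R) ^ 2)) := by
    intro R hR
    have hrect := Complex.integral_boundary_rect_eq_zero_of_differentiableOn H (-R : ℝ)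
      (R + R * I) (fun z hz => (hd z (by
        have := hz.2
        simp only [ofReal_im, add_im, mul_im, ofReal_re, I_im, mul_one, I_re, mul_zero, add_zero,
          zero_add, Set.mem_preimage, Set.uIcc_of_le hR.le] at this
        exact this.1)).differentiableWithinAt)
    simp only [ofReal_re, ofReal_im, add_re, mul_re, I_re, mul_zero, I_im, mul_one, sub_self,
      add_zero, add_im, mul_im, zero_add, ofReal_zero, zero_mul, smul_eq_mul] at hrect
    have htop : ‖∫ x in (-R)..R, H (x + R * I)‖ ≤ A * Real.exp (-c * R) * |R - -R| := by
      refine intervalIntegral.norm_integral_le_of_norm_le_const fun x _ => ?_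
      refine (hH _ (by simpa using hR.le)).trans ?_
      simp only [add_im, ofReal_im, mul_im, ofReal_re, I_im, mul_one, I_re, mul_zero, add_zero,
        zero_add]
      refine mul_le_of_le_one_right (by positivity) (inv_le_one_of_one_le₀ ?_)
      nlinarith [sq_nonneg (ε * (x + R * I : ℂ).re)]
    have hside : ∀ s : ℝ, s ^ 2 = R ^ 2 →
        ‖∫ y in (0 : ℝ)..R, H (s + y * I)‖ ≤ A * (1 + (ε * R) ^ 2)⁻¹ * |R - 0| := by
      intro s hs
      refine intervalIntegral.norm_integral_le_of_norm_le_const fun y hy => ?_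
      rw [Set.uIoc_of_le hR.le] at hy
      refine (hH _ (by simpa using hy.1.le)).trans ?_
      simp only [add_im, ofReal_im, mul_im, ofReal_re, I_im, mul_one, I_re, mul_zero, add_zero,
        zero_add, add_re, mul_re, sub_self]
      rw [mul_pow, hs, ← mul_pow]
      gcongr
      refine mul_le_of_le_one_right hA (Real.exp_le_one_iff.2 ?_)
      nlinarith [mul_pos hc hy.1]
    have h1 := hside R rfl
    have h2 := hside (-R) (by ring)
    rw [show |R - -R| = 2 * R by rw [sub_neg_eq_add, ← two_mul, abs_of_pos (by positivity)]] at htop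
    rw [sub_zero, abs_of_pos hR] at h1 h2
    have e : ∫ x in (-R)..R, H x = (∫ x in (-R)..R, H (x + R * I))
        - I * (∫ y in (0 : ℝ)..R, H (R + y * I)) + I * ∫ y in (0 : ℝ)..R, H ((-R : ℝ) + y * I) := by
      linear_combination hrect
    rw [e]
    refine (norm_add_le _ _).trans ((add_le_add_left (norm_sub_le _ _) _).trans ?_)
    rw [norm_mul, norm_mul, norm_I, one_mul, one_mul, div_eq_mul_inv]
    linarith
  have h1 : Tendsto (fun R : ℝ => R * Real.exp (-c * R)) atTop (𝓝 0) := by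
    simpa using tendsto_rpow_mul_exp_neg_mul_atTop_nhds_zero 1 c hc
  have h2 : Tendsto (fun R : ℝ => R / (1 + (ε * R) ^ 2)) atTop (𝓝 0) := by
    have h3 : Tendsto (fun R : ℝ => (ε ^ 2)⁻¹ * R⁻¹) atTop (𝓝 0) := by
      simpa using tendsto_inv_atTop_zero.const_mul (ε ^ 2)⁻¹
    refine squeeze_zero' ?_ ?_ h3
    · filter_upwards [eventually_gt_atTop 0] with R hR
      positivity
    · filter_upwards [eventually_gt_atTop 0] with R hR
      rw [← mul_inv, ← one_div, div_le_div_iff₀ (by positivity) (by positivity)]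
      nlinarith
  have h3 : Tendsto (fun R : ℝ => ∫ x in (-R)..R, H x) atTop (𝓝 0) := by
    have h4 := (h1.const_mul (2 * A)).add (h2.const_mul (2 * A))
    rw [mul_zero, add_zero] at h4
    refine squeeze_zero_norm' ?_ h4
    filter_upwards [eventually_gt_atTop 0] with R hR using hbound R hR
  exact tendsto_nhds_unique hlim h3

section Spectrum

variable {f : ℂ → ℂ} {M b : ℝ}

/-- For `ω < -b/2` the kernel `e^{-2πiωz}` decays in the upper half-plane faster than `f` grows, and
the pole of the mollifier lies at `-i/ε`, below the real line. -/
theorem fourier_mollified_eq_zero (hf : Differentiable ℂ f) (hb : 0 ≤ b)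
    (htype : ∀ β, Real.pi * b < β → ∃ C, ∀ z, ‖f z‖ ≤ C * Real.exp (β * ‖z‖))
    (hM : ∀ x : ℝ, ‖f x‖ ≤ M) {ε : ℝ} (hε : 0 < ε) {ω : ℝ} (hω : ω < -(b / 2)) :
    𝓕 (fun t : ℝ => f t / (1 - I * ε * t : ℂ) ^ 2) ω = 0 := by
  obtain ⟨β, hβ1, hβ2⟩ : ∃ β, Real.pi * b < β ∧ β < -2 * Real.pi * ω :=
    exists_between (by nlinarith [Real.pi_pos])
  obtain ⟨C, hC⟩ := htype β hβ1
  have hβ : 0 ≤ β := (mul_nonneg Real.pi_pos.le hb).trans hβ1.le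
  -- The weighted bound with `ε = 0`.
  have hfz : ∀ z : ℂ, ‖f z‖ ≤ 2 * M * Real.exp (β * |z.im|) := fun z => by
    simpa using norm_le_of_bound_real_axis hf hβ le_rfl hC (M := M) (by simpa using hM) z
  rw [Real.fourier_real_eq_integral_exp_smul]
  have key := integral_eq_zero_of_decay_upperHalfPlane
    (H := fun z => cexp (-2 * Real.pi * ω * I * z) * (f z / (1 - I * ε * z) ^ 2))
    (A := 2 * M) (c := -2 * Real.pi * ω - β) (by linarith) hε ?_ ?_
  · rw [← key]
    refine integral_congr_ae (Eventually.of_forall fun t => ?_)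
    simp only [smul_eq_mul]
    congr 2
    push_cast
    ring
  · intro z hz
    have hne : (1 - I * ε * z) ^ 2 ≠ 0 := by
      rw [← norm_pos_iff, norm_pow]
      exact lt_of_lt_of_le (by positivity) (one_add_sq_le_norm_sq hε.le hz)
    exact DifferentiableAt.mul (by fun_prop) ((hf z).div (by fun_prop) hne)
  · intro z hz
    have hz1 := hfz z
    rw [abs_of_nonneg hz] at hz1
    have hM0 : 0 ≤ M := (norm_nonneg _).trans (hM 0)
    rw [norm_mul, norm_div, norm_pow, Complex.norm_exp, div_eq_mul_inv, ← mul_assoc]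
    have hre : (-2 * Real.pi * ω * I * z).re = 2 * Real.pi * ω * z.im := by simp
    rw [hre]
    have hexp : 2 * M * Real.exp (-(-2 * Real.pi * ω - β) * z.im)
        = Real.exp (2 * Real.pi * ω * z.im) * (2 * M * Real.exp (β * z.im)) := by
      rw [show -(-2 * Real.pi * ω - β) * z.im = 2 * Real.pi * ω * z.im + β * z.im by ring,
        Real.exp_add]
      ring
    rw [hexp]
    gcongr
    exact one_add_sq_le_norm_sq hε.le hz

/-- The Fourier transform is moved onto the mollified `f`, where it vanishes wherever `φ` does not;
then `ε → 0` with majorant `M |𝓕 φ|`. -/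
theorem integral_fourier_mul_eq_zero (hf : Differentiable ℂ f) (hb : 0 ≤ b)
    (htype : ∀ β, Real.pi * b < β → ∃ C, ∀ z, ‖f z‖ ≤ C * Real.exp (β * ‖z‖))
    (hM : ∀ x : ℝ, ‖f x‖ ≤ M) {φ : ℝ → ℂ} (hφ : Integrable φ) (hφ' : Integrable (𝓕 φ))
    (hsupp : ∀ ω, -(b / 2) ≤ ω → φ ω = 0) :
    ∫ t : ℝ, 𝓕 φ t * f t = 0 := by
  have hM0 : 0 ≤ M := (norm_nonneg _).trans (hM 0)
  have hfr : Continuous fun t : ℝ => f t := hf.continuous.comp continuous_ofReal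
  have hnorm : ∀ ε : ℝ, 0 ≤ ε → ∀ t : ℝ, 1 + (ε * t) ^ 2 ≤ ‖(1 - I * ε * t : ℂ) ^ 2‖ := by
    intro ε hε t
    rw [norm_pow]
    simpa using one_add_sq_le_norm_sq (w := t) hε (by simp)
  have hne : ∀ ε : ℝ, 0 ≤ ε → ∀ t : ℝ, (1 - I * ε * t : ℂ) ^ 2 ≠ 0 := fun ε hε t =>
    norm_pos_iff.1 (lt_of_lt_of_le (by positivity) (hnorm ε hε t))
  have hcont : ∀ ε : ℝ, 0 ≤ ε → Continuous fun t : ℝ => f t / (1 - I * ε * t : ℂ) ^ 2 :=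
    fun ε hε => hfr.div (by fun_prop) (hne ε hε)
  have hle : ∀ ε : ℝ, 0 ≤ ε → ∀ t : ℝ,
      ‖f t / (1 - I * ε * t : ℂ) ^ 2‖ ≤ M * (1 + (ε * t) ^ 2)⁻¹ := by
    intro ε hε t
    rw [norm_div, div_eq_mul_inv]
    gcongr
    · exact hM t
    · exact hnorm ε hε t
  have hzero : ∀ ε : ℝ, 0 < ε → ∫ t : ℝ, 𝓕 φ t * (f t / (1 - I * ε * t : ℂ) ^ 2) = 0 := by
    intro ε hε
    have hint : Integrable fun t : ℝ => f t / (1 - I * ε * t : ℂ) ^ 2 :=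
      ((integrable_inv_one_add_mul_sq hε).const_mul M).mono' (hcont ε hε.le).aestronglyMeasurable
        (Eventually.of_forall (hle ε hε.le))
    have h1 : ∫ t : ℝ, 𝓕 φ t • (f t / (1 - I * ε * t : ℂ) ^ 2)
        = ∫ ω : ℝ, φ ω • 𝓕 (fun t : ℝ => f t / (1 - I * ε * t : ℂ) ^ 2) ω := by
      simpa using! VectorFourier.integral_fourierIntegral_smul_eq_flip (L := innerₗ ℝ)
        Real.continuous_fourierChar continuous_inner hφ hint
    simp only [smul_eq_mul] at h1
    rw [h1]
    refine integral_eq_zero_of_ae (Eventually.of_forall fun ω => ?_)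
    rcases lt_or_ge ω (-(b / 2)) with h | h
    · simp [fourier_mollified_eq_zero hf hb htype hM hε h]
    · simp [hsupp ω h]
  have hlim : Tendsto (fun ε : ℝ => ∫ t : ℝ, 𝓕 φ t * (f t / (1 - I * ε * t : ℂ) ^ 2)) (𝓝[>] 0)
      (𝓝 (∫ t : ℝ, 𝓕 φ t * f t)) := by
    refine tendsto_integral_filter_of_dominated_convergence (fun t => ‖𝓕 φ t‖ * M) ?_ ?_
      (hφ'.norm.mul_const M) ?_
    · filter_upwards [self_mem_nhdsWithin] with ε hε
      exact hφ'.aestronglyMeasurable.mul (hcont ε (le_of_lt hε)).aestronglyMeasurable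
    · filter_upwards [self_mem_nhdsWithin] with ε hε
      refine Eventually.of_forall fun t => ?_
      rw [norm_mul]
      gcongr
      refine (hle ε (le_of_lt hε) t).trans (mul_le_of_le_one_right hM0 (inv_le_one_of_one_le₀ ?_))
      nlinarith [sq_nonneg (ε * t)]
    · refine Eventually.of_forall fun t => Tendsto.const_mul _ ?_
      have : ContinuousAt (fun ε : ℝ => f t / (1 - I * ε * t : ℂ) ^ 2) 0 :=
        ContinuousAt.div (by fun_prop) (by fun_prop) (hne 0 le_rfl t)
      simpa using this.tendsto.mono_left nhdsWithin_le_nhds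
  refine tendsto_nhds_unique hlim (tendsto_const_nhds.congr' ?_)
  filter_upwards [self_mem_nhdsWithin] with ε hε using (hzero ε hε).symm

/-- An entire function of exponential type at most `π b` that is bounded on the real line lies
in `PW_b^∞`. -/
theorem mem_PW_top_of_bounded (hf : Differentiable ℂ f) (hb : 0 ≤ b)
    (htype : ∀ β, Real.pi * b < β → ∃ C, ∀ z, ‖f z‖ ≤ C * Real.exp (β * ‖z‖))
    (hM : ∀ x : ℝ, ‖f x‖ ≤ M) : (fun t : ℝ => f t) ∈ PW b ∞ := by
  have hfr : Continuous fun t : ℝ => f t := hf.continuous.comp continuous_ofReal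
  have hmem : MemLp (fun t : ℝ => f t) ∞ volume :=
    memLp_top_of_bound hfr.aestronglyMeasurable M (Eventually.of_forall hM)
  have happly : ∀ u : 𝓢(ℝ, ℂ),
      (𝓕 (hmem.toLp (fun t : ℝ => f t) : 𝓢'(ℝ, ℂ)) : 𝓢'(ℝ, ℂ)) u =
        ∫ t : ℝ, 𝓕 (u : ℝ → ℂ) t * f t := by
    intro u
    rw [TemperedDistribution.fourier_apply, Lp.toTemperedDistribution_apply]
    refine integral_congr_ae ?_
    filter_upwards [hmem.coeFn_toLp] with t ht
    rw [ht, smul_eq_mul, SchwartzMap.fourier_coe]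
  have hint : ∀ u : 𝓢(ℝ, ℂ), Integrable (𝓕 (u : ℝ → ℂ)) := fun u => by
    rw [← SchwartzMap.fourier_coe]
    exact (𝓕 u).integrable
  refine ⟨hmem, fun ω hω => ?_⟩
  by_contra hnot
  rw [Distribution.mem_dsupport_iff_not_isVanishingOn] at hω
  rw [Set.mem_Icc, not_and_or, not_le, not_le] at hnot
  rcases hnot with h | h
  · refine hω (Set.Iio (-(b / 2))) h isOpen_Iio fun u hu => ?_
    rw [happly]
    refine integral_fourier_mul_eq_zero hf hb htype hM u.integrable (hint u) fun ξ hξ => ?_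
    exact image_eq_zero_of_notMem_tsupport fun hmem => (hu hmem).not_ge hξ
  · refine hω (Set.Ioi (b / 2)) h isOpen_Ioi fun u hu => ?_
    rw [happly]
    -- The right half of the spectrum reduces to the left half by the reflection `z ↦ -z`.
    have hneg : ∀ t : ℝ, 𝓕 (fun ξ : ℝ => u (-ξ)) t = 𝓕 (u : ℝ → ℂ) (-t) := fun t => by
      rw [← Real.fourierInv_eq_fourier_comp_neg, Real.fourierInv_eq_fourier_neg]
    have key := integral_fourier_mul_eq_zero (f := fun z => f (-z)) (M := M) (by fun_prop) hb
      (fun β hβ => (htype β hβ).imp fun C hC z => by simpa using hC (-z))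
      (fun x => by simpa using hM (-x)) u.integrable.comp_neg
      ((hint u).comp_neg.congr (Eventually.of_forall fun t => (hneg t).symm)) fun ξ hξ => by
        refine image_eq_zero_of_notMem_tsupport fun hmem => ?_
        have := hu hmem
        rw [Set.mem_Ioi] at this
        linarith
    rw [← integral_neg_eq_self]
    simpa [hneg] using key

end Spectrum

/-! ### Sampling -/

theorem PWStar.exists_bound {b : ℝ} {f : ℂ → ℂ} (hf : f ∈ PWStar b) {β : ℝ}
    (hβ : Real.pi * b < β) :
    Differentiable ℂ f ∧ ∃ C, ∀ z, ‖f z‖ ≤ C * Real.exp (β * ‖z‖) := by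
  have h : exponentialType f < (β : EReal) := hf.1.trans_lt (EReal.coe_lt_coe_iff.2 hβ)
  simp only [exponentialType, iInf_lt_iff] at h
  obtain ⟨β', ⟨hd, C, hC⟩, hlt⟩ := h
  refine ⟨hd, C, fun z => (hC z).trans ?_⟩
  have hC0 : 0 ≤ C := by
    have := (norm_nonneg _).trans (hC 0)
    simpa using this
  have := (EReal.coe_lt_coe_iff.1 hlt).le
  gcongr

/-- A function in `PW_b^⋆` that is bounded on a relatively dense set lies in `PW_b^∞`. -/
theorem PWStar.mem_PW_top_of_bounded_on_relatively_dense {b : ℝ} (hb : 0 ≤ b) {f : ℂ → ℂ}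
    (hf : f ∈ PWStar b) {S : Set ℝ} {r K : ℝ} (hS : ∀ a : ℝ, ∃ y ∈ S, y ∈ Set.Ico a (a + r))
    (hK : ∀ y ∈ S, ‖f y‖ ≤ K) : (fun t : ℝ => f t) ∈ PW b ∞ := by
  -- Any finite type suffices for the derivative bound; the sharp type matters only for the
  -- spectrum.
  obtain ⟨hd, C, hC⟩ := PWStar.exists_bound hf (lt_add_one (Real.pi * b))
  obtain ⟨L, hL⟩ := exists_norm_deriv_le hd (by positivity) hC hf.2.2
  have hL0 : 0 ≤ L := (norm_nonneg _).trans (hL 0)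
  refine mem_PW_top_of_bounded (M := K + L * r) hd hb (fun β hβ => (PWStar.exists_bound hf hβ).2)
    fun x => ?_
  obtain ⟨y, hyS, hy1, hy2⟩ := hS x
  have h1 := Convex.norm_image_sub_le_of_norm_hasDerivWithin_le (f := fun t : ℝ => f t)
    (f' := fun t : ℝ => deriv f t) (s := Set.univ) (C := L) (x := y) (y := x)
    (fun t _ => (hd t).hasDerivAt.comp_ofReal.hasDerivWithinAt) (fun t _ => hL t) convex_univ
    trivial trivial
  have h2 := norm_sub_norm_le (f x) (f y)
  have h3 : ‖x - y‖ ≤ r := by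
    rw [Real.norm_eq_abs, abs_le]
    constructor <;> linarith
  have := hK y hyS
  have := mul_le_mul_of_nonneg_left h3 hL0
  linarith

theorem exists_relatively_dense_of_lowerUniformDensity_pos {x : ℤ → ℝ}
    (hx : 0 < lowerUniformDensity x) : ∃ r : ℝ, ∀ a : ℝ, ∃ k, x k ∈ Set.Ico a (a + r) := by
  obtain ⟨r, hr⟩ := (frequently_lt_of_lt_limsup (by isBoundedDefault) hx).exists
  refine ⟨r, fun a => ?_⟩
  have h1 := hr.trans_le (iInf_le _ a)
  by_contra! hnot
  have : {k : ℤ | x k ∈ Set.Ico a (a + r)} = ∅ := Set.eq_empty_iff_forall_notMem.2 hnot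
  rw [pointCount, this] at h1
  simp at h1

theorem exists_norm_le_of_memℓp_top {u : ℤ → ℂ} (hu : Memℓp u ∞) : ∃ K, ∀ k, ‖u k‖ ≤ K := by
  obtain ⟨K, hK⟩ := memℓp_infty_iff.1 hu
  exact ⟨K, fun k => hK ⟨k, rfl⟩⟩

end BandlimitedBMO

theorem mainTheorem4 (b : ℝ) (hb : 0 ≤ b) (f : ℂ → ℂ) (hf : f ∈ BandlimitedBMO.PWStar b) :
    ((fun t : ℝ => f t) ∈ BandlimitedBMO.PW b ∞ ∨
      ¬ ∃ x : ℤ → ℝ, BandlimitedBMO.IsSeparatedSeq x ∧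
        0 < BandlimitedBMO.lowerUniformDensity x ∧
        Memℓp (fun k : ℤ => f (x k)) ∞) ∧
    ((fun t : ℝ => f t) ∉ BandlimitedBMO.PW b ∞ →
      ∀ s : ℝ, 0 < s → ¬ Memℓp (fun k : ℤ => f (((k : ℝ) / s : ℝ) : ℂ)) ∞) := by
  have key : ∀ x : ℤ → ℝ, (∃ r : ℝ, ∀ a : ℝ, ∃ k, x k ∈ Set.Ico a (a + r)) →
      Memℓp (fun k : ℤ => f (x k)) ∞ → (fun t : ℝ => f t) ∈ BandlimitedBMO.PW b ∞ := by
    rintro x ⟨r, hr⟩ hx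
    obtain ⟨K, hK⟩ := BandlimitedBMO.exists_norm_le_of_memℓp_top hx
    refine BandlimitedBMO.PWStar.mem_PW_top_of_bounded_on_relatively_dense hb hf
      (S := Set.range x) (r := r) (K := K) (fun a => ?_) ?_
    · obtain ⟨k, hk⟩ := hr a
      exact ⟨x k, ⟨k, rfl⟩, hk⟩
    · rintro _ ⟨k, rfl⟩
      exact hK k
  refine ⟨?_, fun hnot s hs hx => hnot (key (fun k => k / s) ⟨1 / s, fun a => ?_⟩ hx)⟩
  · by_contra! h
    obtain ⟨hnot, x, -, hdens, hx⟩ := h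
    exact hnot (key x (BandlimitedBMO.exists_relatively_dense_of_lowerUniformDensity_pos hdens) hx)
  -- The ceiling fits the half-open window: `a * s ≤ ⌈a * s⌉ < a * s + 1`.
  · refine ⟨⌈a * s⌉, ?_, ?_⟩
    · rw [le_div_iff₀ hs]
      exact Int.le_ceil _
    · rw [div_lt_iff₀ hs, add_mul, one_div, inv_mul_cancel₀ hs.ne']
      exact Int.ceil_lt_add_one _
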